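/- Let $S_1,S_2$ be compact Hausdorff spaces. For a compact Hausdorff space $S$, let $C(S,[0,1])$ be the set of all continuous functions $S\to[0,1]$, regarded as an MV-algebra under the pointwise operations $(f\oplus g)(s)=\min\{f(s)+g(s),1\}$, $(\neg f)(s)=1-f(s)$ and the constant $0$; its underlying lattice operations $f\vee g=\neg(\neg f\oplus g)\oplus g$ and $f\wedge g=\neg(\neg f\vee\neg g)$ are the pointwise maximum and minimum. An MV-subalgebra of $C(S,[0,1])$ is a subset that contains $0$ and is closed under $\oplus$ and $\neg$ (it is then also closed under $\vee$ and $\wedge$, hence a lattice). A subset $B\subseteq C(S,[0,1])$ separates the points of $S$ if for all $p\neq q$ in $S$ there is $b\in B$ with $b(p)=0$ and $b(q)>0$. (i) Let $A_i\subseteq C(S_i,[0,1])$ ($i=1,2$) be MV-subalgebras such that $A_i$ separates the points of $S_i$ for $i=1,2$. If $A_1$ and $A_2$ are isomorphic as lattices, then $S_1$ and $S_2$ are homeomorphic. (ii) The lattices $C(S_1,[0,1])$ and $C(S_2,[0,1])$ are isomorphic if and only if $S_1$ and $S_2$ are homeomorphic. -/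

import Mathlib

/-- `B ⊆ C(S, [0,1])` separates the points of `S`: for all `p ≠ q` in `S` there is `b ∈ B` with
`b p = 0` and `b q > 0`. -/
def SeparatesThePoints {S : Type*} [TopologicalSpace S] (B : Set C(S, unitInterval)) : Prop :=
  ∀ p q : S, p ≠ q → ∃ b ∈ B, b p = 0 ∧ 0 < b q

/-- An MV-algebra `(M, ⊕, ¬, 0)`: a commutative monoid `(M, ⊕, 0)` with an involutive unary
operation `¬` such that `¬0` is absorbing for `⊕` and `¬(¬x ⊕ y) ⊕ y = ¬(¬y ⊕ x) ⊕ x`. -/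
class MVAlgebra (M : Type*) extends Zero M where
  oplus : M → M → M
  neg : M → M
  oplus_assoc (x y z : M) : oplus (oplus x y) z = oplus x (oplus y z)
  oplus_comm (x y : M) : oplus x y = oplus y x
  oplus_zero (x : M) : oplus x 0 = x
  neg_neg (x : M) : neg (neg x) = x
  oplus_neg_zero (x : M) : oplus x (neg 0) = neg 0
  neg_oplus_oplus (x y : M) :
    oplus (neg (oplus (neg x) y)) y = oplus (neg (oplus (neg y) x)) x

namespace MVAlgebra

variable {M : Type*} [MVAlgebra M]

/-- The join `x ∨ y := ¬(¬x ⊕ y) ⊕ y` of the underlying lattice of an MV-algebra. -/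
def join (x y : M) : M := oplus (neg (oplus (neg x) y)) y

/-- The meet `x ∧ y := ¬(¬x ∨ ¬y)` of the underlying lattice of an MV-algebra. -/
def meet (x y : M) : M := neg (join (neg x) (neg y))

end MVAlgebra

/-- An MV-subalgebra: a subset that contains `0` and is closed under `⊕` and `¬`. -/
structure MVSubalgebra (M : Type*) [MVAlgebra M] where
  carrier : Set M
  zero_mem : (0 : M) ∈ carrier
  oplus_mem {x y : M} : x ∈ carrier → y ∈ carrier → MVAlgebra.oplus x y ∈ carrier
  neg_mem {x : M} : x ∈ carrier → MVAlgebra.neg x ∈ carrier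

/-- The standard MV-algebra `[0,1]`: `x ⊕ y = min (x + y) 1` and `¬x = 1 - x`. -/
noncomputable instance unitInterval.instMVAlgebra : MVAlgebra unitInterval where
  toZero := inferInstance
  oplus x y := ⟨min ((x : ℝ) + y) 1,
    le_min (add_nonneg x.2.1 y.2.1) zero_le_one, min_le_right _ _⟩
  neg x := unitInterval.symm x
  oplus_assoc x y z := by
    have hx := x.2.1; have hy := y.2.1; have hz := z.2.1
    apply Subtype.ext
    simp only
    grind
  oplus_comm x y := by
    apply Subtype.ext
    simp only [add_comm]
  oplus_zero x := by
    apply Subtype.ext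
    simp [x.2.2]
  neg_neg x := by simp
  oplus_neg_zero x := by
    apply Subtype.ext
    simp [x.2.1]
  neg_oplus_oplus x y := by
    have hx := x.2.1; have hy := y.2.1
    apply Subtype.ext
    simp only [unitInterval.coe_symm_eq]
    grind

/-- `C(S, [0,1])` with the pointwise operations of the standard MV-algebra `[0,1]`. -/
noncomputable instance ContinuousMap.instMVAlgebra {S : Type*} [TopologicalSpace S] :
    MVAlgebra C(S, unitInterval) where
  toZero := inferInstance
  oplus f g := ⟨fun s => MVAlgebra.oplus (f s) (g s), by
    refine Continuous.subtype_mk ?_ _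
    fun_prop⟩
  neg f := ⟨fun s => MVAlgebra.neg (f s), unitInterval.continuous_symm.comp f.continuous⟩
  oplus_assoc f g h := ContinuousMap.ext fun s => MVAlgebra.oplus_assoc (f s) (g s) (h s)
  oplus_comm f g := ContinuousMap.ext fun s => MVAlgebra.oplus_comm (f s) (g s)
  oplus_zero f := ContinuousMap.ext fun s => MVAlgebra.oplus_zero (f s)
  neg_neg f := ContinuousMap.ext fun s => MVAlgebra.neg_neg (f s)
  oplus_neg_zero f := ContinuousMap.ext fun s => MVAlgebra.oplus_neg_zero (f s)
  neg_oplus_oplus f g := ContinuousMap.ext fun s => MVAlgebra.neg_oplus_oplus (f s) (g s)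

/-- In `C(S, [0,1])` the MV-join is the pointwise maximum. -/
theorem ContinuousMap.mvJoin_eq_sup {S : Type*} [TopologicalSpace S]
    (f g : C(S, unitInterval)) : MVAlgebra.join f g = f ⊔ g := by
  refine ContinuousMap.ext fun s => Subtype.ext ?_
  have hf := (f s).2.2
  have hg := (g s).2.2
  have hf' := (f s).2.1
  have hg' := (g s).2.1
  change min ((1 - min ((1 - (f s : ℝ)) + g s) 1) + (g s : ℝ)) 1 = ((f s ⊔ g s : unitInterval) : ℝ)
  rw [show ((f s ⊔ g s : unitInterval) : ℝ) = max (f s : ℝ) (g s) from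
    Monotone.map_sup (Subtype.mono_coe _) _ _]
  grind

/-- In `C(S, [0,1])` the MV-meet is the pointwise minimum. -/
theorem ContinuousMap.mvMeet_eq_inf {S : Type*} [TopologicalSpace S]
    (f g : C(S, unitInterval)) : MVAlgebra.meet f g = f ⊓ g := by
  rw [MVAlgebra.meet, ContinuousMap.mvJoin_eq_sup]
  refine ContinuousMap.ext fun s => ?_
  change unitInterval.symm (unitInterval.symm (f s) ⊔ unitInterval.symm (g s)) = f s ⊓ g s
  rcases le_total (f s) (g s) with h | h
  · rw [sup_eq_left.2 (unitInterval.symm_le_symm.2 h), inf_eq_left.2 h, unitInterval.symm_symm]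
  · rw [sup_eq_right.2 (unitInterval.symm_le_symm.2 h), inf_eq_right.2 h, unitInterval.symm_symm]

namespace MVSubalgebra

variable {S : Type*} [TopologicalSpace S]

theorem sup_mem (A : MVSubalgebra C(S, unitInterval)) {f g : C(S, unitInterval)}
    (hf : f ∈ A.carrier) (hg : g ∈ A.carrier) : f ⊔ g ∈ A.carrier := by
  rw [← ContinuousMap.mvJoin_eq_sup]
  exact A.oplus_mem (A.neg_mem (A.oplus_mem (A.neg_mem hf) hg)) hg

theorem inf_mem (A : MVSubalgebra C(S, unitInterval)) {f g : C(S, unitInterval)}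
    (hf : f ∈ A.carrier) (hg : g ∈ A.carrier) : f ⊓ g ∈ A.carrier := by
  rw [← ContinuousMap.mvMeet_eq_inf, MVAlgebra.meet, ContinuousMap.mvJoin_eq_sup]
  exact A.neg_mem (A.sup_mem (A.neg_mem hf) (A.neg_mem hg))

/-- The underlying lattice of an MV-subalgebra of `C(S, [0,1])`. Its join and meet are the
MV-join and MV-meet, that is, the pointwise maximum and minimum. -/
instance instLattice (A : MVSubalgebra C(S, unitInterval)) : Lattice A.carrier :=
  Subtype.lattice (fun _ _ hf hg => A.sup_mem hf hg) (fun _ _ hf hg => A.inf_mem hf hg)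

end MVSubalgebra

/-- Two lattices are isomorphic: there is a bijective lattice homomorphism between them. -/
def LatticeIsomorphic (L M : Type*) [Lattice L] [Lattice M] : Prop :=
  ∃ f : LatticeHom L M, Function.Bijective f

/-!
A sublattice `L` of `C(S, [0,1])` with enough functions remembers `S`. Say that `f` is well inside
`g` if some `h` has `f ⊓ h = ⊥` and `h ⊔ g = ⊤`; pointwise this forces `g = 1` wherever `f ≠ 0`.
The functions equal to `1` near a point form a filter each of whose members has another member well
inside it. By compactness every proper filter with this property is contained in one arising from a
point, so the points of `S` are the maximal ones, and the sets of points near which a given `g ∈ L`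
equals `1` form a basis of `S`. All of this is expressed by the lattice `L` alone.

For an MV-subalgebra, "enough functions" comes from multiples of truncated differences: if
`a p = 0 < a q` and `b q = 0 < b p`, then `n (b ⊖ a)` and `n (a ⊖ b)` are disjoint, and for large
`n` they are `1` near `p` and near `q` respectively.
-/

open scoped Filter Topology

section RoundSpectrum

variable {L : Type*} [Lattice L] [BoundedOrder L]

/-- The well-inside (or rather-below) relation of pointfree topology. -/
def WellInside (f g : L) : Prop :=
  ∃ h, Disjoint f h ∧ Codisjoint h g

/-- A proper round filter: one not containing `⊥`, each of whose members has a member well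
inside it. -/
structure IsProperRound (F : Order.PFilter L) : Prop where
  bot_notMem : ⊥ ∉ F
  exists_wellInside : ∀ g ∈ F, ∃ f ∈ F, WellInside f g

variable (L) in
/-- The spectrum of a bounded lattice formed by its maximal proper round filters, from which the
underlying space is recovered. -/
def RoundSpectrum : Type _ :=
  {F : Order.PFilter L // Maximal IsProperRound F}

namespace RoundSpectrum

/-- The basic open set of maximal proper round filters containing `g`. -/
def basicOpen (g : L) : Set (RoundSpectrum L) :=
  {F | g ∈ F.1}

instance : TopologicalSpace (RoundSpectrum L) :=
  .generateFrom (Set.range basicOpen)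

end RoundSpectrum

end RoundSpectrum

section Separation

variable {S X : Type*} [TopologicalSpace S] [LinearOrder X] [BoundedOrder X]

/-- A family of functions separates points from closed sets, in the strong form needed to recover
the topology: for every neighbourhood `U` of `x`, two disjoint members of the family are `⊤` near
`x` and off `U` respectively. -/
def SeparatesFromClosed (B : Set (S → X)) : Prop :=
  ∀ x, ∀ U ∈ 𝓝 x, ∃ f ∈ B, ∃ g ∈ B, Disjoint f g ∧ f =ᶠ[𝓝 x] ⊤ ∧ ∀ s ∉ U, g s = ⊤

theorem separatesFromClosed_of_isSublattice [CompactSpace S] {B : Set (S → X)} (hB : IsSublattice B)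
    (hbot : ⊥ ∈ B) (htop : ⊤ ∈ B)
    (hsep : ∀ p q, p ≠ q → ∃ f ∈ B, ∃ g ∈ B, Disjoint f g ∧ f =ᶠ[𝓝 p] ⊤ ∧ g =ᶠ[𝓝 q] ⊤) :
    SeparatesFromClosed B := by
  intro x U hU
  have hx : x ∉ closure Uᶜ := by
    rwa [closure_compl, Set.notMem_compl_iff, mem_interior_iff_mem_nhds]
  suffices ∃ f ∈ B, ∃ g ∈ B, Disjoint f g ∧ f =ᶠ[𝓝 x] ⊤ ∧ ∀ s ∈ closure Uᶜ, g s = ⊤ by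
    obtain ⟨f, hf, g, hg, hfg, hfx, hgU⟩ := this
    exact ⟨f, hf, g, hg, hfg, hfx, fun s hs => hgU s (subset_closure hs)⟩
  refine isClosed_closure.isCompact.induction_on
    (p := fun K => ∃ f ∈ B, ∃ g ∈ B, Disjoint f g ∧ f =ᶠ[𝓝 x] ⊤ ∧ ∀ s ∈ K, g s = ⊤) ?_ ?_ ?_ ?_
  · exact ⟨⊤, htop, ⊥, hbot, disjoint_bot_right, .rfl, fun _ hs => hs.elim⟩
  · rintro K K' hKK' ⟨f, hf, g, hg, hfg, hfx, hgK'⟩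
    exact ⟨f, hf, g, hg, hfg, hfx, fun s hs => hgK' s (hKK' hs)⟩
  · rintro K K' ⟨f, hf, g, hg, hfg, hfx, hgK⟩ ⟨f', hf', g', hg', hfg', hfx', hgK'⟩
    refine ⟨f ⊓ f', hB.infClosed hf hf', g ⊔ g', hB.supClosed hg hg', ?_, ?_, ?_⟩
    · exact (hfg.mono_left inf_le_left).sup_right (hfg'.mono_left inf_le_right)
    · filter_upwards [hfx, hfx'] with s hs hs'
      simp [hs, hs']
    · rintro s (hs | hs)
      · simp [hgK s hs]
      · simp [hgK' s hs]
  · intro q hq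
    obtain ⟨f, hf, g, hg, hfg, hfx, hgq⟩ := hsep x q (by rintro rfl; exact hx hq)
    exact ⟨{s | g s = ⊤}, mem_nhdsWithin_of_mem_nhds hgq, f, hf, g, hg, hfg, hfx, fun _ hs => hs⟩

end Separation

section Reconstruction

variable {L S X : Type*} [Lattice L] [BoundedOrder L] [LinearOrder X] [BoundedOrder X]
  {e : BoundedLatticeHom L (S → X)}

theorem WellInside.apply_eq_top {f g : L} (hfg : WellInside f g) {s : S} (hs : e f s ≠ ⊥) :
    e g s = ⊤ := by
  obtain ⟨h, hfh, hhg⟩ := hfg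
  have hh : e h s = ⊥ :=
    (min_eq_bot.1 (disjoint_iff.1 (Pi.disjoint_iff.1 (hfh.map e) s))).resolve_left hs
  have hg := codisjoint_iff.1 (Pi.codisjoint_iff.1 (hhg.map e) s)
  rwa [hh, bot_sup_eq] at hg

theorem wellInside_of_apply (he : Function.Injective e) {f g h : L} (hfh : Disjoint (e f) (e h))
    (hhg : ∀ s, e g s ≠ ⊤ → e h s = ⊤) : WellInside f g := by
  refine ⟨h, disjoint_iff.2 (he ?_), codisjoint_iff.2 (he ?_)⟩
  · rw [map_inf, map_bot, hfh.eq_bot]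
  · rw [map_sup, map_top]
    funext s
    by_cases hs : e g s = ⊤
    · simp [hs]
    · simp [hhg s hs]

variable [TopologicalSpace S]

variable (e) in
/-- The filter of lattice elements represented by functions that are `⊤` near `x`. -/
def topGerm (x : S) : Order.PFilter L :=
  Order.IsPFilter.toPFilter (F := {f | e f =ᶠ[𝓝 x] ⊤}) <| .of_def
    ⟨⊤, by simp⟩
    (fun f hf g hg => ⟨f ⊓ g, by filter_upwards [hf, hg] with s hfs hgs; simp [hfs, hgs],
      inf_le_left, inf_le_right⟩)
    (fun hfg hf => by
      filter_upwards [hf] with s hs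
      exact top_le_iff.1 (hs.ge.trans (OrderHomClass.mono e hfg s)))

theorem apply_eq_top_of_mem_topGerm {f : L} {x : S} (hf : f ∈ topGerm e x) : e f x = ⊤ :=
  Filter.EventuallyEq.eq_of_nhds hf

theorem isProperRound_topGerm [Nontrivial X] (he : Function.Injective e)
    (hsep : SeparatesFromClosed (Set.range e)) (x : S) : IsProperRound (topGerm e x) where
  bot_notMem h := by
    simpa using apply_eq_top_of_mem_topGerm h
  exists_wellInside g hg := by
    obtain ⟨_, ⟨f, rfl⟩, _, ⟨h, rfl⟩, hfh, hfx, hhU⟩ := hsep x _ hg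
    exact ⟨f, hfx, wellInside_of_apply he hfh hhU⟩

theorem isTopologicalBasis_mem_topGerm [Nontrivial X] (hsep : SeparatesFromClosed (Set.range e)) :
    TopologicalSpace.IsTopologicalBasis (Set.range fun g => {x | g ∈ topGerm e x}) := by
  refine TopologicalSpace.isTopologicalBasis_of_isOpen_of_nhds ?_ fun x U hx hU => ?_
  · rintro _ ⟨g, rfl⟩
    exact isOpen_setOfPred_eventually_nhds
  · obtain ⟨_, ⟨f, rfl⟩, _, ⟨g, rfl⟩, hfg, hfx, hgU⟩ := hsep x U (hU.mem_nhds hx)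
    refine ⟨_, ⟨f, rfl⟩, hfx, fun y hy => ?_⟩
    have hfy : e f y = ⊤ := apply_eq_top_of_mem_topGerm hy
    by_contra hyU
    have hbot := disjoint_iff.1 (Pi.disjoint_iff.1 hfg y)
    simp [hfy, hgU y hyU] at hbot

theorem eq_of_topGerm_le [Nontrivial X] [T1Space S] (hsep : SeparatesFromClosed (Set.range e))
    {x y : S} (h : topGerm e x ≤ topGerm e y) : x = y := by
  by_contra hxy
  obtain ⟨_, ⟨f, rfl⟩, hfx, hfy⟩ := (isTopologicalBasis_mem_topGerm hsep).exists_subset_of_mem_open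
    (show x ∈ {y}ᶜ from hxy) isOpen_compl_singleton
  have hyf : f ∈ topGerm e y := h hfx
  exact hfy hyf rfl

theorem IsProperRound.exists_le_topGerm [CompactSpace S] [TopologicalSpace X] [T1Space X]
    [Nontrivial X] (he : Function.Injective e) (hcont : ∀ f, Continuous (e f))
    {F : Order.PFilter L} (hF : IsProperRound F) : ∃ x, F ≤ topGerm e x := by
  have hclosed (g : F) : IsClosed {s | e g s = ⊤} := isClosed_singleton.preimage (hcont g)
  have : Nonempty F := F.nonempty.to_subtype
  obtain ⟨x, hx⟩ : (⋂ g : F, {s | e g s = ⊤}).Nonempty := by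
    refine IsCompact.nonempty_iInter_of_directed_nonempty_isCompact_isClosed _ ?_ ?_
      (fun g => (hclosed g).isCompact) hclosed
    · rintro ⟨f, hf⟩ ⟨g, hg⟩
      refine ⟨⟨f ⊓ g, Order.PFilter.inf_mem hf hg⟩, fun s hs => ?_, fun s hs => ?_⟩ <;>
        simp_all
    · rintro ⟨g, hg⟩
      obtain ⟨f, hf, hfg⟩ := hF.exists_wellInside g hg
      have hne : e f ≠ ⊥ := fun h => hF.bot_notMem (he (h.trans (map_bot e).symm) ▸ hf)
      obtain ⟨s, hs⟩ := Function.ne_iff.1 hne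
      exact ⟨s, hfg.apply_eq_top hs⟩
  refine ⟨x, fun g hg => ?_⟩
  obtain ⟨f, hf, hfg⟩ := hF.exists_wellInside g hg
  have hfx : e f x = ⊤ := Set.mem_iInter.1 hx ⟨f, hf⟩
  filter_upwards [(hcont f).continuousAt.eventually_ne (hfx.trans_ne top_ne_bot)] with s hs
  exact hfg.apply_eq_top hs

variable [CompactSpace S] [T1Space S] [TopologicalSpace X] [T1Space X] [Nontrivial X]

theorem maximal_isProperRound_iff (he : Function.Injective e) (hcont : ∀ f, Continuous (e f))
    (hsep : SeparatesFromClosed (Set.range e)) {F : Order.PFilter L} :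
    Maximal IsProperRound F ↔ ∃ x, topGerm e x = F := by
  constructor
  · intro hF
    obtain ⟨x, hx⟩ := hF.prop.exists_le_topGerm he hcont
    exact ⟨x, (hF.eq_of_le (isProperRound_topGerm he hsep x) hx).symm⟩
  · rintro ⟨x, rfl⟩
    refine ⟨isProperRound_topGerm he hsep x, fun G hG hxG => ?_⟩
    obtain ⟨y, hy⟩ := hG.exists_le_topGerm he hcont
    rwa [eq_of_topGerm_le hsep (hxG.trans hy)]

namespace RoundSpectrum

variable (he : Function.Injective e) (hcont : ∀ f, Continuous (e f))
  (hsep : SeparatesFromClosed (Set.range e))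

/-- The point `x` as a point of the spectrum of a lattice of functions. -/
def ofPoint (x : S) : RoundSpectrum L :=
  ⟨topGerm e x, (maximal_isProperRound_iff he hcont hsep).2 ⟨x, rfl⟩⟩

theorem ofPoint_bijective : Function.Bijective (ofPoint he hcont hsep) := by
  refine ⟨fun x y hxy => eq_of_topGerm_le hsep (congrArg Subtype.val hxy).le, fun F => ?_⟩
  obtain ⟨x, hx⟩ := (maximal_isProperRound_iff he hcont hsep).1 F.2
  exact ⟨x, Subtype.ext hx⟩

theorem isInducing_ofPoint : Topology.IsInducing (ofPoint he hcont hsep) where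
  eq_induced := by
    refine (isTopologicalBasis_mem_topGerm hsep).eq_generateFrom.trans
      (.trans ?_ induced_generateFrom_eq.symm)
    rw [← Set.range_comp]
    rfl

/-- The reconstruction of a compact space from any lattice of functions on it that separates
points from closed sets. -/
noncomputable def homeomorph : S ≃ₜ RoundSpectrum L :=
  (Equiv.ofBijective _ (ofPoint_bijective he hcont hsep)).toHomeomorphOfIsInducing
    (isInducing_ofPoint he hcont hsep)

end RoundSpectrum

end Reconstruction

namespace MVAlgebra

variable {M : Type*} [MVAlgebra M]

/-- The truncated difference `x ⊖ y = ¬(¬x ⊕ y)` of an MV-algebra. -/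
def sub (x y : M) : M := neg (oplus (neg x) y)

/-- The `n`-fold sum `x ⊕ ⋯ ⊕ x` in an MV-algebra. -/
def multiple (x : M) : ℕ → M
  | 0 => 0
  | n + 1 => oplus (multiple x n) x

end MVAlgebra

namespace MVSubalgebra

variable {M : Type*} [MVAlgebra M] (A : MVSubalgebra M)

theorem sub_mem {x y : M} (hx : x ∈ A.carrier) (hy : y ∈ A.carrier) :
    MVAlgebra.sub x y ∈ A.carrier :=
  A.neg_mem (A.oplus_mem (A.neg_mem hx) hy)

theorem multiple_mem {x : M} (hx : x ∈ A.carrier) : ∀ n, MVAlgebra.multiple x n ∈ A.carrier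
  | 0 => A.zero_mem
  | n + 1 => A.oplus_mem (multiple_mem hx n) hx

end MVSubalgebra

namespace MVAlgebra

variable {S : Type*} [TopologicalSpace S]

theorem coe_sub_apply (f g : C(S, unitInterval)) (s : S) :
    (sub f g s : ℝ) = max (f s - g s : ℝ) 0 := by
  change 1 - min (1 - (f s : ℝ) + g s) 1 = _
  grind

theorem coe_multiple_apply (f : C(S, unitInterval)) (n : ℕ) (s : S) :
    (multiple f n s : ℝ) = min (n * f s : ℝ) 1 := by
  induction n with
  | zero => simp [multiple]
  | succ n ih =>
    change min ((multiple f n s : ℝ) + f s) 1 = _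
    have := (f s).2.1
    push_cast
    grind

theorem multiple_apply_eq_zero {f : C(S, unitInterval)} {s : S} (hs : f s = 0) (n : ℕ) :
    multiple f n s = 0 :=
  Subtype.ext <| by simp [coe_multiple_apply, hs]

theorem disjoint_multiple_sub (f g : C(S, unitInterval)) (m n : ℕ) :
    Disjoint (⇑(multiple (sub f g) m)) ⇑(multiple (sub g f) n) := by
  have sub_eq_zero {f g : C(S, unitInterval)} {s : S} (h : f s ≤ g s) : sub f g s = 0 :=
    Subtype.ext <| by rw [coe_sub_apply]; exact max_eq_right (sub_nonpos.2 h)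
  refine Pi.disjoint_iff.2 fun s => disjoint_iff.2 (min_eq_bot.2 ?_)
  exact (le_total (f s) (g s)).imp (fun h => multiple_apply_eq_zero (sub_eq_zero h) m)
    (fun h => multiple_apply_eq_zero (sub_eq_zero h) n)

theorem eventually_multiple_eq_top {f : C(S, unitInterval)} {x : S} (hx : 0 < f x) :
    ∃ n, ⇑(multiple f n) =ᶠ[𝓝 x] ⊤ := by
  obtain ⟨n, hn⟩ := exists_lt_nsmul (show (0 : ℝ) < f x from hx) 1
  have hcont : Continuous fun s => n • (f s : ℝ) := by fun_prop
  refine ⟨n, (hcont.continuousAt.eventually (lt_mem_nhds hn)).mono fun s hs => Subtype.ext ?_⟩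
  rw [coe_multiple_apply, ← nsmul_eq_mul, min_eq_right hs.le]
  rfl

end MVAlgebra

theorem SeparatesThePoints.t2Space {S : Type*} [TopologicalSpace S] {B : Set C(S, unitInterval)}
    (hB : SeparatesThePoints B) : T2Space S where
  t2 p q hpq := by
    obtain ⟨b, -, hp, hq⟩ := hB p q hpq
    exact separated_by_continuous b.continuous (hp.trans_lt hq).ne

namespace MVSubalgebra

variable {S T : Type*} [TopologicalSpace S] [TopologicalSpace T]
  (A : MVSubalgebra C(S, unitInterval)) {B : MVSubalgebra C(T, unitInterval)}

theorem one_mem : 1 ∈ A.carrier := by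
  convert A.neg_mem A.zero_mem
  exact ContinuousMap.ext fun _ => unitInterval.symm_zero.symm

instance instBoundedOrder : BoundedOrder A.carrier where
  top := ⟨1, A.one_mem⟩
  le_top _ := fun _ => unitInterval.le_one'
  bot := ⟨0, A.zero_mem⟩
  bot_le _ := fun _ => unitInterval.nonneg'

/-- The elements of an MV-subalgebra of `C(S, [0,1])` as functions on `S`. -/
def toFunHom : BoundedLatticeHom A.carrier (S → unitInterval) where
  toFun f := f.1
  map_sup' _ _ := rfl
  map_inf' _ _ := rfl
  map_top' := rfl
  map_bot' := rfl

theorem toFunHom_injective : Function.Injective A.toFunHom :=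
  DFunLike.coe_injective.comp Subtype.val_injective

theorem continuous_toFunHom (f : A.carrier) : Continuous (A.toFunHom f) :=
  f.1.continuous

variable {A}

theorem exists_disjoint_eventuallyEq_top (hA : SeparatesThePoints A.carrier) {p q : S}
    (hpq : p ≠ q) : ∃ f ∈ Set.range A.toFunHom, ∃ g ∈ Set.range A.toFunHom,
      Disjoint f g ∧ f =ᶠ[𝓝 p] ⊤ ∧ g =ᶠ[𝓝 q] ⊤ := by
  obtain ⟨a, ha, hap, haq⟩ := hA p q hpq
  obtain ⟨b, hb, hbq, hbp⟩ := hA q p hpq.symm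
  have sub_pos {f g : C(S, unitInterval)} {s : S} (hg : g s = 0) (hf : 0 < f s) :
      0 < MVAlgebra.sub f g s := by
    rw [← Subtype.coe_lt_coe, MVAlgebra.coe_sub_apply, hg]
    exact lt_max_of_lt_left (by simpa using hf)
  obtain ⟨m, hm⟩ := MVAlgebra.eventually_multiple_eq_top (sub_pos hap hbp)
  obtain ⟨n, hn⟩ := MVAlgebra.eventually_multiple_eq_top (sub_pos hbq haq)
  exact ⟨_, ⟨⟨_, A.multiple_mem (A.sub_mem hb ha) m⟩, rfl⟩,
    _, ⟨⟨_, A.multiple_mem (A.sub_mem ha hb) n⟩, rfl⟩, MVAlgebra.disjoint_multiple_sub b a m n,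
    hm, hn⟩

theorem separatesFromClosed [CompactSpace S] (hA : SeparatesThePoints A.carrier) :
    SeparatesFromClosed (Set.range A.toFunHom) := by
  refine separatesFromClosed_of_isSublattice ⟨?_, ?_⟩ ⟨⊥, rfl⟩ ⟨⊤, rfl⟩
    fun _ _ => exists_disjoint_eventuallyEq_top hA
  · rintro _ ⟨f, rfl⟩ _ ⟨g, rfl⟩
    exact ⟨f ⊔ g, rfl⟩
  · rintro _ ⟨f, rfl⟩ _ ⟨g, rfl⟩
    exact ⟨f ⊓ g, rfl⟩

theorem nonempty_homeomorph_of_orderIso [CompactSpace S] [CompactSpace T]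
    (hA : SeparatesThePoints A.carrier) (hB : SeparatesThePoints B.carrier)
    (φ : A.carrier ≃o B.carrier) : Nonempty (S ≃ₜ T) := by
  have := hA.t2Space
  have := hB.t2Space
  let e : BoundedLatticeHom A.carrier (T → unitInterval) := B.toFunHom.comp φ
  have he : SeparatesFromClosed (Set.range e) :=
    φ.surjective.range_comp B.toFunHom ▸ separatesFromClosed hB
  exact ⟨(RoundSpectrum.homeomorph A.toFunHom_injective A.continuous_toFunHom
    (separatesFromClosed hA)).trans (RoundSpectrum.homeomorph (e := e)
      (B.toFunHom_injective.comp φ.injective) (fun f => B.continuous_toFunHom (φ f)) he).symm⟩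

variable (S) in
/-- `C(S, [0,1])` as an MV-subalgebra of itself. -/
def full : MVSubalgebra C(S, unitInterval) where
  carrier := Set.univ
  zero_mem := trivial
  oplus_mem _ _ := trivial
  neg_mem _ := trivial

theorem separatesThePoints_full [CompletelyRegularSpace S] [T1Space S] :
    SeparatesThePoints (full S).carrier := by
  intro p q hpq
  obtain ⟨f, hf, hfp, hfq⟩ :=
    CompletelyRegularSpace.completely_regular p {q} isClosed_singleton hpq
  exact ⟨⟨f, hf⟩, trivial, hfp, by simp [hfq rfl]⟩

variable (S) in
/-- The full MV-subalgebra is order isomorphic to `C(S, [0,1])`. -/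
def fullOrderIso : (full S).carrier ≃o C(S, unitInterval) :=
  OrderIso.Set.univ

end MVSubalgebra

theorem LatticeIsomorphic.nonempty_orderIso {L M : Type*} [Lattice L] [Lattice M]
    (h : LatticeIsomorphic L M) : Nonempty (L ≃o M) := by
  obtain ⟨f, hf⟩ := h
  exact ⟨.ofSurjective (orderEmbeddingOfInjective f hf.injective) hf.surjective⟩

theorem LatticeIsomorphic.of_orderIso {L M : Type*} [Lattice L] [Lattice M] (φ : L ≃o M) :
    LatticeIsomorphic L M :=
  ⟨φ, φ.bijective⟩

/-- Precomposition with a homeomorphism as an isomorphism of function lattices. -/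
def orderIsoOfHomeomorph {S T X : Type*} [TopologicalSpace S] [TopologicalSpace T]
    [TopologicalSpace X] [PartialOrder X] (e : S ≃ₜ T) : C(S, X) ≃o C(T, X) where
  toEquiv := e.arrowCongr (.refl X)
  map_rel_iff' := (e.symm.surjective.forall (p := fun _ => _ ≤ _)).symm

theorem corollary7p8 {S₁ S₂ : Type*}
    [TopologicalSpace S₁] [CompactSpace S₁] [T2Space S₁]
    [TopologicalSpace S₂] [CompactSpace S₂] [T2Space S₂] :
    (∀ (A₁ : MVSubalgebra C(S₁, unitInterval)) (A₂ : MVSubalgebra C(S₂, unitInterval)),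
      SeparatesThePoints A₁.carrier → SeparatesThePoints A₂.carrier →
      LatticeIsomorphic A₁.carrier A₂.carrier → Nonempty (S₁ ≃ₜ S₂)) ∧
    (LatticeIsomorphic C(S₁, unitInterval) C(S₂, unitInterval) ↔ Nonempty (S₁ ≃ₜ S₂)) := by
  refine ⟨fun A₁ A₂ h₁ h₂ h => ?_, fun h => ?_, fun ⟨e⟩ => .of_orderIso (orderIsoOfHomeomorph e)⟩
  · obtain ⟨φ⟩ := h.nonempty_orderIso
    exact MVSubalgebra.nonempty_homeomorph_of_orderIso h₁ h₂ φ
  · obtain ⟨φ⟩ := h.nonempty_orderIso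
    exact MVSubalgebra.nonempty_homeomorph_of_orderIso
      MVSubalgebra.separatesThePoints_full MVSubalgebra.separatesThePoints_full
      ((MVSubalgebra.fullOrderIso S₁).trans (φ.trans (MVSubalgebra.fullOrderIso S₂).symm))
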